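/- Let $(S,\mathfrak m,k)$ and $(T,\mathfrak n,k)$ be commutative Noetherian local rings with common residue field $k$, let $\pi_S: S\to k$ and $\pi_T: T\to k$ be the natural surjections, and assume that neither $S$ nor $T$ is a field. Let $$R = S\times_k T=\{(s,t)\in S\times T \mid \pi_S(s)=\pi_T(t)\}$$ be the fiber product, and regard $S$-modules and $T$-modules as $R$-modules via the projections $R\to S$, $(s,t)\mapsto s$, and $R\to T$, $(s,t)\mapsto t$. Let $Y$ be a nonzero finitely generated $S$-module, let $Z$ be a nonzero finitely generated $T$-module, and let $m\ge 0$ be an integer. If $\operatorname{Tor}^R_m(Y,Z)=0$, then $m$ is odd, $Y$ is a free $S$-module and $Z$ is a free $T$-module. -/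

import Mathlib

universe u v

/-- The fiber product `S ×ₖ T = {(s, t) ∈ S × T | πS s = πT t}`, a subring of `S × T`. -/
def fiberProduct {S T : Type u} {k : Type v} [CommRing S] [CommRing T] [CommRing k]
    (πS : S →+* k) (πT : T →+* k) : Subring (S × T) :=
  RingHom.eqLocus (πS.comp (RingHom.fst S T)) (πT.comp (RingHom.snd S T))

namespace fiberProduct

variable {S T : Type u} {k : Type v} [CommRing S] [CommRing T] [CommRing k]

theorem mem_iff (πS : S →+* k) (πT : T →+* k) (x : S × T) :
    x ∈ fiberProduct πS πT ↔ πS x.1 = πT x.2 := Iff.rfl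

/-- The projection `(s, t) ↦ s` from the fiber product to `S`. -/
def toLeft (πS : S →+* k) (πT : T →+* k) : fiberProduct πS πT →+* S :=
  (RingHom.fst S T).comp (fiberProduct πS πT).subtype

/-- The projection `(s, t) ↦ t` from the fiber product to `T`. -/
def toRight (πS : S →+* k) (πT : T →+* k) : fiberProduct πS πT →+* T :=
  (RingHom.snd S T).comp (fiberProduct πS πT).subtype

end fiberProduct

/-! Write `R` for the fiber product, `I` and `J` for the kernels of `R → T` and `R → S`. Then `I ⊓ J
= ⊥`, `I ⊔ J` is the maximal ideal, `J` kills `Y` and `I` kills `Z`. If `J` kills `M ≠ 0`, every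
vector with coordinates in `J` is a relation of a minimal cover of `M`, so `J` is a retract of the
first syzygy; and `I` kills `J`. Each dimension shift thus swaps the two ideals, and descending to
degree 0 or 1 contradicts Nakayama in one parity (`even_and_odd_false`); hence `m` is odd. For `Z`,
the part `C` of the syzygy with coordinates in `J` is a retract killed by `I`. As `Tor_{m-1}(Y, C) =
0` with `m - 1` even, `C = 0`: all relations lie in `I`, so `Z` is free over `T = R/I`
(`hasRelationsIn_right`). For `Y`, shifting down to degree 1 makes `Y ⊗ I → Y` injective, and
Nakayama then puts the relations of `Y` in `J` (`hasRelationsIn_left`). -/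

/-! ### Splicing projective resolutions -/

open CategoryTheory Limits in
/-- Splicing a projective resolution `D` of `K` with a projective object: if
`0 ⟶ K ⟶ F ⟶ M ⟶ 0` is exact, then `D` followed by `F` is a projective resolution of `M`. -/
theorem exists_projectiveResolution_augment {C : Type*} [Category* C] [Abelian C]
    {K F M : C} [Projective F] (ι : K ⟶ F) (f : F ⟶ M) [Mono ι] [Epi f] (w : ι ≫ f = 0)
    (hex : (ShortComplex.mk ι f w).Exact) (D : ChainComplex C ℕ) [∀ n, Projective (D.X n)]
    (p : D.X 0 ⟶ K) [Epi p] (hp : D.d 1 0 ≫ p = 0) (hD₀ : (ShortComplex.mk _ _ hp).Exact)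
    (hD : ∀ n, (ShortComplex.mk _ _ (D.d_comp_d (n + 2) (n + 1) n)).Exact)
    (h0 : D.d 1 0 ≫ p ≫ ι = 0) :
    ∃ Q : ProjectiveResolution M, Q.complex = ChainComplex.augment D (p ≫ ι) h0 := by
  have hw : (p ≫ ι) ≫ f = 0 := by rw [Category.assoc, w, comp_zero]
  -- Precomposing with the epimorphism `p` does not change the image of `ι`.
  have hF : (ShortComplex.mk (p ≫ ι) f hw).Exact := by
    let α : ShortComplex.mk (p ≫ ι) f hw ⟶ ShortComplex.mk ι f w :=
      { τ₁ := p, τ₂ := 𝟙 _, τ₃ := 𝟙 _ }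
    have : Epi α.τ₁ := inferInstanceAs (Epi p)
    have : IsIso α.τ₂ := inferInstanceAs (IsIso (𝟙 _))
    have : Mono α.τ₃ := inferInstanceAs (Mono (𝟙 _))
    rw [ShortComplex.exact_iff_of_epi_of_isIso_of_mono α]
    exact hex
  -- Composing with the monomorphism `ι` does not change the kernel of `p`.
  have hP : (ShortComplex.mk (D.d 1 0) (p ≫ ι) h0).Exact := by
    let α : ShortComplex.mk (D.d 1 0) p hp ⟶ ShortComplex.mk (D.d 1 0) (p ≫ ι) h0 :=
      { τ₁ := 𝟙 _, τ₂ := 𝟙 _, τ₃ := ι }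
    have : Epi α.τ₁ := inferInstanceAs (Epi (𝟙 _))
    have : IsIso α.τ₂ := inferInstanceAs (IsIso (𝟙 _))
    have : Mono α.τ₃ := inferInstanceAs (Mono ι)
    rw [← ShortComplex.exact_iff_of_epi_of_isIso_of_mono α]
    exact hD₀
  refine ⟨{ complex := ChainComplex.augment D (p ≫ ι) h0
            projective := ?_
            π := (ChainComplex.toSingle₀Equiv _ _).symm ⟨f, hw⟩
            quasiIso := ⟨fun n => ?_⟩ }, rfl⟩
  · rintro (_ | n)
    · exact inferInstanceAs (Projective F)
    · exact inferInstanceAs (Projective (D.X n))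
  · rcases n with _ | n
    · rw [ChainComplex.quasiIsoAt₀_iff, ShortComplex.quasiIso_iff_of_zeros']
      · refine (ShortComplex.exact_and_epi_g_iff_of_iso ?_).2 ⟨hF, ‹Epi f›⟩
        exact ShortComplex.isoMk (Iso.refl _) (Iso.refl _) (Iso.refl _)
          ((Category.id_comp _).trans (Category.comp_id _).symm)
          ((Category.id_comp f).trans ((Category.comp_id f).symm.trans (by
            refine congrArg (· ≫ 𝟙 M) ?_
            exact (ChainComplex.toSingle₀Equiv_symm_apply_f_zero
              (C := ChainComplex.augment D (p ≫ ι) h0) f hw).symm)))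
      all_goals rfl
    · rw [quasiIsoAt_iff_exactAt']
      · rw [HomologicalComplex.exactAt_iff' _ (n + 1 + 1) (n + 1) n (by simp) (by simp)]
        rcases n with _ | n
        · exact hP
        · exact hD n
      · apply ChainComplex.exactAt_succ_single_obj

/-! ### Vanishing of Tor and dimension shifting -/

namespace CategoryTheory

open Limits TensorProduct

variable {R : Type u} [CommRing R]

/-- The vanishing of `Tor_i(X, M)` for modules over `R`. -/
def TorVanishes (i : ℕ) (R : Type u) [CommRing R] (X M : Type u) [AddCommGroup X] [Module R X]
    [AddCommGroup M] [Module R M] : Prop :=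
  IsZero (((Tor (ModuleCat.{u} R) i).obj (ModuleCat.of R X)).obj (ModuleCat.of R M))

variable {X M N F : Type u} [AddCommGroup X] [Module R X] [AddCommGroup M] [Module R M]
  [AddCommGroup N] [Module R N] [AddCommGroup F] [Module R F]

theorem TorVanishes.of_retract {i : ℕ} (h : TorVanishes i R X M) (a : N →ₗ[R] M)
    (p : M →ₗ[R] N) (hpa : p ∘ₗ a = LinearMap.id) : TorVanishes i R X N := by
  let G := (Tor (ModuleCat.{u} R) i).obj (ModuleCat.of R X)
  rw [TorVanishes, IsZero.iff_id_eq_zero]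
  have h1 : ModuleCat.ofHom a ≫ ModuleCat.ofHom p = 𝟙 (ModuleCat.of R N) := by
    rw [← ModuleCat.ofHom_comp, hpa]; rfl
  have h2 : G.map (ModuleCat.ofHom a) ≫ G.map (ModuleCat.ofHom p) =
      𝟙 (G.obj (ModuleCat.of R N)) := by
    rw [← G.map_comp, h1, G.map_id]
  refine h2.symm.trans ?_
  rw [(show IsZero (G.obj (ModuleCat.of R M)) from h).eq_zero_of_tgt (G.map (ModuleCat.ofHom a)),
    zero_comp]

theorem TorVanishes.subsingleton_tensorProduct (h : TorVanishes 0 R X M) :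
    Subsingleton (X ⊗[R] M) := by
  let G := (MonoidalCategory.tensoringLeft (ModuleCat.{u} R)).obj (ModuleCat.of R X)
  have hl : PreservesFiniteColimits G :=
    inferInstanceAs (PreservesFiniteColimits (MonoidalCategory.tensorLeft (ModuleCat.of R X)))
  have := IsZero.of_iso h ((Functor.leftDerivedZeroIsoSelf G).app (ModuleCat.of R M)).symm
  exact ModuleCat.subsingleton_of_isZero this

theorem torVanishes_iff_exactAt (P : ProjectiveResolution (ModuleCat.of R M)) (i : ℕ) :
    TorVanishes i R X M ↔ ((((MonoidalCategory.tensoringLeft (ModuleCat.{u} R)).obj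
      (ModuleCat.of R X)).mapHomologicalComplex _).obj P.complex).ExactAt i := by
  rw [HomologicalComplex.exactAt_iff_isZero_homology]
  exact (P.isoLeftDerivedObj _ i).isZero_iff

theorem exists_resolution_of_surjective [Module.Free R F] (f : F →ₗ[R] M)
    (hf : Function.Surjective f)
    (P : ProjectiveResolution (ModuleCat.of R (LinearMap.ker f)))
    (p : P.complex.X 0 ⟶ ModuleCat.of R (LinearMap.ker f)) (hp : p = P.π.f 0) :
    ∃ (Q : ProjectiveResolution (ModuleCat.of R M))
      (w : P.complex.d 1 0 ≫ p ≫ ModuleCat.ofHom (LinearMap.ker f).subtype = 0),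
      Q.complex = ChainComplex.augment P.complex
        (p ≫ ModuleCat.ofHom (LinearMap.ker f).subtype) w := by
  have : Projective (ModuleCat.of R F) := ModuleCat.projective_of_free (Module.Free.chooseBasis R F)
  have : Mono (ModuleCat.ofHom (LinearMap.ker f).subtype) :=
    (ModuleCat.mono_iff_injective _).2 Subtype.val_injective
  have : Epi (ModuleCat.ofHom f) := (ModuleCat.epi_iff_surjective _).2 hf
  have w : ModuleCat.ofHom (LinearMap.ker f).subtype ≫ ModuleCat.ofHom f = 0 := by
    ext x; exact x.2
  have hdp : P.complex.d 1 0 ≫ p = 0 := by rw [hp]; exact P.complex_d_comp_π_f_zero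
  have h0 : P.complex.d 1 0 ≫ p ≫ ModuleCat.ofHom (LinearMap.ker f).subtype = 0 := by
    rw [← Category.assoc, hdp, zero_comp]
  have : Epi p := by rw [hp]; exact inferInstanceAs (Epi (P.π.f 0))
  subst hp
  obtain ⟨Q, hQ⟩ := exists_projectiveResolution_augment (ModuleCat.ofHom (LinearMap.ker f).subtype)
    (ModuleCat.ofHom f) w (by
      rw [ShortComplex.moduleCat_exact_iff]
      intro x hx
      exact ⟨⟨x, hx⟩, rfl⟩) P.complex _ hdp P.exact₀ P.exact_succ h0
  exact ⟨Q, h0, hQ⟩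

/-- In degrees `i + 3`, `i + 2`, `i + 1` the spliced resolution of `M` is the resolution of the
kernel in degrees `i + 2`, `i + 1`, `i`; `F` sits in degree 0 and is not involved. -/
theorem TorVanishes.ker [Module.Free R F] {i : ℕ} (h : TorVanishes (i + 2) R X M)
    (f : F →ₗ[R] M) (hf : Function.Surjective f) :
    TorVanishes (i + 1) R X (LinearMap.ker f) := by
  let P := ProjectiveResolution.of (ModuleCat.of R (LinearMap.ker f))
  obtain ⟨Q, w, hQ⟩ := exists_resolution_of_surjective f hf P _ rfl
  rw [torVanishes_iff_exactAt Q, hQ,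
    HomologicalComplex.exactAt_iff' _ (i + 3) (i + 2) (i + 1) (by simp) (by simp)] at h
  rw [torVanishes_iff_exactAt P,
    HomologicalComplex.exactAt_iff' _ (i + 2) (i + 1) i (by simp) (by simp)]
  exact h

/-- Substitute for the shift in degree 1, where the spliced resolution reads `P₁ → P₀ → F`: a class
killed in `X ⊗ F` lifts to `X ⊗ P₀`, comes from `X ⊗ P₁`, hence is zero. -/
theorem TorVanishes.lTensor_ker_subtype_injective [Module.Free R F] (h : TorVanishes 1 R X M)
    (f : F →ₗ[R] M) (hf : Function.Surjective f) :
    Function.Injective ((LinearMap.ker f).subtype.lTensor X) := by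
  let P := ProjectiveResolution.of (ModuleCat.of R (LinearMap.ker f))
  obtain ⟨Q, w, hQ⟩ := exists_resolution_of_surjective f hf P _ rfl
  rw [torVanishes_iff_exactAt Q, hQ,
    HomologicalComplex.exactAt_iff' _ 2 1 0 (by simp) (by simp),
    ShortComplex.moduleCat_exact_iff] at h
  let d : P.complex.X 1 →ₗ[R] P.complex.X 0 := (P.complex.d 1 0).hom
  let p : P.complex.X 0 →ₗ[R] LinearMap.ker f := (P.π.f 0).hom
  have hpd : p ∘ₗ d = 0 := congrArg ModuleCat.Hom.hom P.complex_d_comp_π_f_zero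
  have hp : Function.Surjective p := (ModuleCat.epi_iff_surjective (P.π.f 0)).1 inferInstance
  have h' : ∀ x : X ⊗[R] P.complex.X 0, ((LinearMap.ker f).subtype ∘ₗ p).lTensor X x = 0 →
      ∃ y : X ⊗[R] P.complex.X 1, d.lTensor X y = x := h
  rw [injective_iff_map_eq_zero]
  intro z hz
  obtain ⟨x, rfl⟩ := LinearMap.lTensor_surjective X hp z
  obtain ⟨y, rfl⟩ := h' x (by rw [LinearMap.lTensor_comp]; exact hz)
  rw [← LinearMap.comp_apply, ← LinearMap.lTensor_comp, hpd, LinearMap.lTensor_zero,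
    LinearMap.zero_apply]

end CategoryTheory

/-! ### Minimal covers and Nakayama -/

namespace IsLocalRing

open TensorProduct

variable {R : Type*} [CommRing R] [IsLocalRing R]

theorem exists_minimal_cover (M : Type*) [AddCommGroup M] [Module R M] [Module.Finite R M] :
    ∃ (n : ℕ) (f : (Fin n → R) →ₗ[R] M), Function.Surjective f ∧
      ∀ x, f x = 0 → ∀ i, x i ∈ maximalIdeal R := by
  let b := Module.finBasis (ResidueField R) (ResidueField R ⊗[R] M)
  choose v hv using fun i => TensorProduct.mk_surjective R M (ResidueField R) residue_surjective (b i)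
  refine ⟨_, Fintype.linearCombination R v, ?_, fun x hx i => ?_⟩
  · rw [← LinearMap.range_eq_top, Fintype.range_linearCombination]
    exact span_eq_top_of_tmul_eq_basis v b hv
  · have h1 : ∑ j, residue R (x j) • b j = 0 := by
      have h2 := congrArg (TensorProduct.mk R (ResidueField R) M 1) hx
      rw [Fintype.linearCombination_apply, map_sum, map_zero] at h2
      rw [← h2]
      refine Finset.sum_congr rfl fun j _ => ?_
      rw [map_smul, hv]
      exact algebraMap_smul (ResidueField R) (x j) (b j)
    rw [← residue_eq_zero_iff]
    exact Fintype.linearIndependent_iff.1 b.linearIndependent _ h1 i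

theorem nontrivial_tensorProduct_of_finite (M N : Type*) [AddCommGroup M] [Module R M]
    [Module.Finite R M] [AddCommGroup N] [Module R N] [Module.Finite R N]
    [Nontrivial M] [Nontrivial N] : Nontrivial (M ⊗[R] N) := by
  let k := ResidueField R
  have hM : Nontrivial (k ⊗[R] M) := not_subsingleton_iff_nontrivial.1 fun h =>
    not_subsingleton M (subsingleton_tensorProduct.1 h)
  have hN : Nontrivial (k ⊗[R] N) := not_subsingleton_iff_nontrivial.1 fun h =>
    not_subsingleton N (subsingleton_tensorProduct.1 h)
  have h1 : Nontrivial ((k ⊗[R] M) ⊗[k] (k ⊗[R] N)) :=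
    (Module.FaithfullyFlat.nontrivial_tensorProduct_iff_right k _).2 hN
  have h2 : Nontrivial (k ⊗[R] (M ⊗[R] N)) :=
    (AlgebraTensorModule.distribBaseChange R k M N).toEquiv.nontrivial
  exact not_subsingleton_iff_nontrivial.1 fun h =>
    not_subsingleton (k ⊗[R] (M ⊗[R] N)) inferInstance

end IsLocalRing

/-! ### Syzygies over a ring with two ideals meeting in zero -/

section IdealSum

variable {R : Type*} [CommRing R] {I J : Ideal R}

theorem Ideal.exists_projections_of_inf_eq_bot (hIJ : I ⊓ J = ⊥) :
    ∃ (p : ↥(I ⊔ J) →ₗ[R] I) (q : ↥(I ⊔ J) →ₗ[R] J), ∀ x, (p x : R) + q x = x := by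
  let s : (I × J) →ₗ[R] ↥(I ⊔ J) :=
    (Submodule.inclusion le_sup_left).coprod (Submodule.inclusion le_sup_right)
  have hs : Function.Bijective s := by
    constructor
    · rw [injective_iff_map_eq_zero]
      rintro ⟨a, b⟩ hab
      have h : (a : R) + b = 0 := congrArg Subtype.val hab
      have ha : (a : R) ∈ I ⊓ J := ⟨a.2, by rw [eq_neg_of_add_eq_zero_left h]; exact J.neg_mem b.2⟩
      rw [hIJ, Submodule.mem_bot] at ha
      rw [ha, zero_add] at h
      exact Prod.ext (Subtype.ext ha) (Subtype.ext h)
    · rintro ⟨x, hx⟩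
      obtain ⟨a, ha, b, hb, rfl⟩ := Submodule.mem_sup.1 hx
      exact ⟨(⟨a, ha⟩, ⟨b, hb⟩), rfl⟩
  let e := LinearEquiv.ofBijective s hs
  refine ⟨LinearMap.fst R I J ∘ₗ e.symm.toLinearMap, LinearMap.snd R I J ∘ₗ e.symm.toLinearMap,
    fun x => ?_⟩
  exact congrArg Subtype.val (e.apply_symm_apply x)

variable {n : ℕ} {M : Type*} [AddCommGroup M] [Module R M]

theorem LinearMap.apply_eq_zero_of_coord_mem (f : (Fin n → R) →ₗ[R] M)
    (hM : ∀ r ∈ J, ∀ x : M, r • x = 0) {v : Fin n → R} (hv : ∀ i, v i ∈ J) : f v = 0 := by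
  rw [LinearMap.pi_apply_eq_sum_univ]
  exact Finset.sum_eq_zero fun i _ => hM _ (hv i) _

/-- The kernel of a minimal cover of a module killed by `J` retracts onto its part in `I ^ n`. -/
theorem LinearMap.exists_retraction_ker_inf_pi (hIJ : I ⊓ J = ⊥) (f : (Fin n → R) →ₗ[R] M)
    (hf : ∀ x, f x = 0 → ∀ i, x i ∈ I ⊔ J) (hM : ∀ r ∈ J, ∀ x : M, r • x = 0) :
    ∃ q : ker f →ₗ[R] ↥(ker f ⊓ Submodule.pi Set.univ fun _ => I),
      q ∘ₗ Submodule.inclusion inf_le_left = id ∧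
        ∀ (x : ker f) i, (x : Fin n → R) i - (q x : Fin n → R) i ∈ J := by
  obtain ⟨p, q, hpq⟩ := Ideal.exists_projections_of_inf_eq_bot hIJ
  let c (i : Fin n) : ker f →ₗ[R] ↥(I ⊔ J) :=
    (LinearMap.proj i ∘ₗ (ker f).subtype).codRestrict _ fun x => hf x x.2 i
  let g : ker f →ₗ[R] (Fin n → R) := LinearMap.pi fun i => I.subtype ∘ₗ p ∘ₗ c i
  have hg (x : ker f) (i : Fin n) : (x : Fin n → R) i - g x i ∈ J := by
    have h : g x i + q (c i x) = (x : Fin n → R) i := hpq (c i x)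
    rw [← h, add_sub_cancel_left]
    exact (q _).2
  have hgI (x : ker f) (i : Fin n) : g x i ∈ I := (p _).2
  refine ⟨g.codRestrict _ fun x => ⟨?_, fun i _ => hgI x i⟩, ?_, hg⟩
  -- The `J`-part of a relation is itself a relation, hence so is the `I`-part `g x`.
  · have h := f.apply_eq_zero_of_coord_mem hM (v := (x : Fin n → R) - g x) (hg x)
    rw [map_sub, mem_ker.1 x.2, zero_sub, neg_eq_zero] at h
    exact h
  · ext x i
    have h : (x : Fin n → R) i - g ⟨x, x.2.1⟩ i ∈ I ⊓ J :=
      ⟨I.sub_mem (x.2.2 i trivial) (hgI _ i), hg ⟨x, x.2.1⟩ i⟩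
    rw [hIJ, Submodule.mem_bot, sub_eq_zero] at h
    exact h.symm

/-- The ideal `J` is a retract of the kernel of a minimal cover of a module killed by `J`. -/
theorem LinearMap.exists_retraction_ker_ideal (hIJ : I ⊓ J = ⊥) (f : (Fin n → R) →ₗ[R] M)
    (hf : ∀ x, f x = 0 → ∀ i, x i ∈ I ⊔ J) (hM : ∀ r ∈ J, ∀ x : M, r • x = 0) (i : Fin n) :
    ∃ (a : J →ₗ[R] ker f) (q : ker f →ₗ[R] J), q ∘ₗ a = id ∧
      (ker f).subtype ∘ₗ a = LinearMap.single R (fun _ => R) i ∘ₗ J.subtype := by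
  obtain ⟨p, q, hpq⟩ := Ideal.exists_projections_of_inf_eq_bot hIJ
  let c : ker f →ₗ[R] ↥(I ⊔ J) :=
    (LinearMap.proj i ∘ₗ (ker f).subtype).codRestrict _ fun x => hf x x.2 i
  let a : J →ₗ[R] ker f := (LinearMap.single R (fun _ => R) i ∘ₗ J.subtype).codRestrict _ fun r =>
    f.apply_eq_zero_of_coord_mem hM fun j => by
      by_cases h : j = i
      · subst h; simp
      · simp [h]
  refine ⟨a, q ∘ₗ c, ?_, rfl⟩
  ext r
  have h1 : (c (a r) : R) = r := Pi.single_eq_same (M := fun _ : Fin n => R) i (r : R)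
  have h2 : (p (c (a r)) : R) + q (c (a r)) = r := (hpq _).trans h1
  have h3 : (p (c (a r)) : R) ∈ I ⊓ J :=
    ⟨(p _).2, by rw [eq_sub_of_add_eq h2]; exact J.sub_mem r.2 (q _).2⟩
  rw [hIJ, Submodule.mem_bot] at h3
  rw [h3, zero_add] at h2
  exact h2

open TensorProduct

theorem LinearMap.lTensor_eq_zero_of_coord_mem {A : Type*} [AddCommGroup A] [Module R A]
    (X : Type*) [AddCommGroup X] [Module R X] (hX : ∀ r ∈ J, ∀ x : X, r • x = 0)
    (g : A →ₗ[R] (Fin n → R)) (hg : ∀ a i, g a i ∈ J) : g.lTensor X = 0 := by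
  refine TensorProduct.ext' fun x a => ?_
  rw [lTensor_tmul, zero_apply, pi_eq_sum_univ' (g a), tmul_sum]
  refine Finset.sum_eq_zero fun i _ => ?_
  rw [tmul_smul, smul_tmul', hX _ (hg a i), zero_tmul]

/-- `X ⊗ A → X ⊗ Rⁿ` is injective, being a split injection followed by an injection, yet zero
because `J` kills `X`. -/
theorem LinearMap.subsingleton_tensorProduct_of_retract {A K : Type*} [AddCommGroup A] [Module R A]
    [AddCommGroup K] [Module R K]
    (X : Type*) [AddCommGroup X] [Module R X] (hX : ∀ r ∈ J, ∀ x : X, r • x = 0)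
    (g : K →ₗ[R] (Fin n → R)) (hg : Function.Injective (g.lTensor X)) (a : A →ₗ[R] K)
    (q : K →ₗ[R] A) (hqa : q ∘ₗ a = id) (hga : ∀ x i, g (a x) i ∈ J) : Subsingleton (X ⊗[R] A) := by
  have h0 : (g ∘ₗ a).lTensor X = 0 := lTensor_eq_zero_of_coord_mem X hX _ hga
  have h1 (t : X ⊗[R] A) : t = 0 := by
    have h2 : a.lTensor X t = 0 := hg (by
      rw [map_zero, ← comp_apply, ← lTensor_comp, h0, zero_apply])
    rw [← lTensor_id_apply X A t, ← hqa, lTensor_comp, comp_apply, h2, map_zero]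
  exact ⟨fun s t => (h1 s).trans (h1 t).symm⟩

end IdealSum

/-! ### From an injective `X ⊗ I → X` to relations in `J` -/

section LocalRing

open TensorProduct IsLocalRing

variable {R : Type*} [CommRing R] [IsLocalRing R] [IsNoetherianRing R] {I J : Ideal R}

/-- `M` has finitely many generators all of whose relations have coefficients in `J`. -/
def HasRelationsIn (J : Ideal R) (M : Type*) [AddCommGroup M] [Module R M] : Prop :=
  ∃ (n : ℕ) (f : (Fin n → R) →ₗ[R] M), Function.Surjective f ∧ ∀ x, f x = 0 → ∀ i, x i ∈ J

/-- Let `K` be the syzygy and `C` its part in `Iⁿ`. Injectivity gives `C ≤ I • K`, while `I • K ≤ I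
• C` since `I` kills `J`-coordinates; Nakayama yields `C = ⊥`. -/
theorem HasRelationsIn.of_lTensor_injective (hIJ : I ⊓ J = ⊥) (hm : I ⊔ J = maximalIdeal R)
    (X : Type*) [AddCommGroup X] [Module R X] [Module.Finite R X]
    (hX : ∀ r ∈ J, ∀ x : X, r • x = 0) (h : Function.Injective (I.subtype.lTensor X)) :
    HasRelationsIn J X := by
  obtain ⟨n, f, hf, hmin⟩ := exists_minimal_cover (R := R) X
  refine ⟨n, f, hf, ?_⟩
  obtain ⟨q, -, hqJ⟩ := f.exists_retraction_ker_inf_pi hIJ (by rwa [hm]) hX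
  let C := LinearMap.ker f ⊓ Submodule.pi Set.univ fun _ => I
  have hIker : I • LinearMap.ker f ≤ I • C := by
    refine Submodule.smul_le.2 fun r hr x hx => ?_
    have h1 : r • x = r • (q ⟨x, hx⟩ : Fin n → R) := by
      ext i
      have h2 : r * (x i - (q ⟨x, hx⟩ : Fin n → R) i) ∈ I ⊓ J :=
        ⟨I.mul_mem_right _ hr, J.mul_mem_left _ (hqJ ⟨x, hx⟩ i)⟩
      rw [hIJ, Submodule.mem_bot, mul_sub, sub_eq_zero] at h2
      exact h2
    rw [h1]
    exact Submodule.smul_mem_smul hr (q _).2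
  have hC : C ≤ I • C := by
    intro c hc
    -- The image of `t` in `X ⊗ R` is `f c = 0`, so `t` comes from `K ⊗ I`; multiplying out by `μ`
    -- turns `t` back into `c`.
    let t : (Fin n → R) ⊗[R] I := ∑ i, Pi.single i 1 ⊗ₜ[R] ⟨c i, hc.2 i trivial⟩
    have ht : f.rTensor I t = 0 := by
      apply h
      have h1 : ∑ i, c i • f (Pi.single i 1) = 0 := by
        have h2 := congrArg f (pi_eq_sum_univ' c)
        rw [map_sum, show f c = 0 from hc.1] at h2
        simpa only [map_smul] using h2.symm
      rw [map_zero, map_sum, map_sum]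
      simp only [LinearMap.rTensor_tmul, LinearMap.lTensor_tmul, Submodule.subtype_apply]
      rw [← zero_tmul X (1 : R), ← h1, sum_tmul]
      refine Finset.sum_congr rfl fun i _ => ?_
      rw [smul_tmul, smul_eq_mul, mul_one]
    obtain ⟨u, hu⟩ := (rTensor_exact I (LinearMap.exact_subtype_ker_map f) hf t).1 ht
    let μ : (Fin n → R) ⊗[R] I →ₗ[R] (Fin n → R) :=
      TensorProduct.lift ((LinearMap.lsmul R (Fin n → R)).flip.compl₂ I.subtype)
    have hμ (v : Fin n → R) (r : I) : μ (v ⊗ₜ r) = (r : R) • v := rfl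
    have hμt : μ t = c := by
      rw [map_sum]
      simp only [hμ]
      exact (pi_eq_sum_univ' c).symm
    have hμu (u : LinearMap.ker f ⊗[R] I) :
        μ ((LinearMap.ker f).subtype.rTensor I u) ∈ I • LinearMap.ker f := by
      induction u with
      | zero => rw [map_zero, map_zero]; exact Submodule.zero_mem _
      | tmul x r => exact Submodule.smul_mem_smul r.2 x.2
      | add x y hx hy => rw [map_add, map_add]; exact add_mem hx hy
    rw [← hμt, ← hu]
    exact hIker (hμu u)
  have hC0 : C = ⊥ := Submodule.eq_bot_of_le_smul_of_le_jacobson_bot I C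
    (IsNoetherian.noetherian C) hC
    ((le_sup_left.trans hm.le).trans (maximalIdeal_le_jacobson ⊥))
  intro x hx i
  have h0 : (q ⟨x, hx⟩ : Fin n → R) = 0 := by
    rw [← Submodule.mem_bot R, ← hC0]; exact (q _).2
  have := hqJ ⟨x, hx⟩ i
  rwa [h0, Pi.zero_apply, sub_zero] at this

end LocalRing

/-! ### Parity of vanishing Tor and location of the relations -/

namespace CategoryTheory.TorVanishes

open TensorProduct IsLocalRing

variable {R : Type u} [CommRing R] [IsLocalRing R] {I J : Ideal R}
  {X M : Type u} [AddCommGroup X] [Module R X] [AddCommGroup M] [Module R M]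
  [Module.Finite R M] {i : ℕ}

theorem ideal [Nontrivial M] (h : TorVanishes (i + 2) R X M) (hIJ : I ⊓ J = ⊥)
    (hm : I ⊔ J = maximalIdeal R) (hM : ∀ r ∈ J, ∀ x : M, r • x = 0) :
    TorVanishes (i + 1) R X J := by
  obtain ⟨n, f, hf, hmin⟩ := exists_minimal_cover (R := R) M
  rcases n with _ | n
  · exact absurd hf.subsingleton (not_subsingleton M)
  obtain ⟨a, q, hqa, -⟩ := f.exists_retraction_ker_ideal hIJ (by rwa [hm]) hM 0
  exact (h.ker f hf).of_retract a q hqa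

theorem lTensor_ideal_subtype_injective [Nontrivial M] (h : TorVanishes 1 R X M)
    (hIJ : I ⊓ J = ⊥) (hm : I ⊔ J = maximalIdeal R) (hM : ∀ r ∈ J, ∀ x : M, r • x = 0) :
    Function.Injective (J.subtype.lTensor X) := by
  obtain ⟨n, f, hf, hmin⟩ := exists_minimal_cover (R := R) M
  rcases n with _ | n
  · exact absurd hf.subsingleton (not_subsingleton M)
  obtain ⟨a, q, hqa, ha⟩ := f.exists_retraction_ker_ideal hIJ (by rwa [hm]) hM 0
  have h1 : Function.Injective (a.lTensor X) := by
    refine Function.LeftInverse.injective (g := q.lTensor X) fun t => ?_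
    rw [← LinearMap.comp_apply, ← LinearMap.lTensor_comp, hqa, LinearMap.lTensor_id_apply]
  have h2 := (h.lTensor_ker_subtype_injective f hf).comp h1
  rw [← LinearMap.coe_comp, ← LinearMap.lTensor_comp, ha, LinearMap.lTensor_comp,
    LinearMap.coe_comp] at h2
  exact h2.of_comp

variable [IsNoetherianRing R] [Module.Finite R X]

theorem even_and_odd_false [Nontrivial X] (hIJ : I ⊓ J = ⊥)
    (hm : I ⊔ J = maximalIdeal R) (hI : I ≠ ⊥) (hJ : J ≠ ⊥)
    (hX : ∀ r ∈ J, ∀ x : X, r • x = 0) (i : ℕ) :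
    ∀ (M : Type u) [AddCommGroup M] [Module R M] [Module.Finite R M] [Nontrivial M],
      (Even i → (∀ r ∈ I, ∀ x : M, r • x = 0) → ¬ TorVanishes i R X M) ∧
      (Odd i → (∀ r ∈ J, ∀ x : M, r • x = 0) → ¬ TorVanishes i R X M) := by
  have : Nontrivial I := Submodule.nontrivial_iff_ne_bot.2 hI
  have : Nontrivial J := Submodule.nontrivial_iff_ne_bot.2 hJ
  have hmul (a b : R) (ha : a ∈ I) (hb : b ∈ J) : a * b = 0 := by
    rw [← Ideal.mem_bot, ← hIJ]
    exact ⟨I.mul_mem_right _ ha, J.mul_mem_left _ hb⟩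
  have hIkilled : ∀ r ∈ J, ∀ x : I, r • x = 0 := fun r hr x =>
    Subtype.ext ((mul_comm r x.1).trans (hmul x r x.2 hr))
  have hJkilled : ∀ r ∈ I, ∀ x : J, r • x = 0 := fun r hr x => Subtype.ext (hmul r x hr x.2)
  have hm' : J ⊔ I = maximalIdeal R := by rwa [sup_comm]
  have hIJ' : J ⊓ I = ⊥ := by rwa [inf_comm]
  induction i with
  | zero =>
    intro M _ _ _ _
    refine ⟨fun _ _ h => ?_, fun h => absurd h (by decide)⟩
    have := nontrivial_tensorProduct_of_finite (R := R) X M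
    exact not_subsingleton _ h.subsingleton_tensorProduct
  | succ i ih =>
    intro M _ _ _ _
    -- Degree 1 is separate: there `X ⊗ J → X ⊗ R` would be both injective and zero, with nonzero
    -- source.
    rcases i with _ | i
    · refine ⟨fun h => absurd h (by decide), fun _ hM h => ?_⟩
      have hinj := h.lTensor_ideal_subtype_injective hIJ hm hM
      have := nontrivial_tensorProduct_of_finite (R := R) X J
      obtain ⟨t, ht⟩ := exists_ne (0 : X ⊗[R] J)
      refine ht (hinj ?_)
      have h0 : J.subtype.lTensor X = 0 := TensorProduct.ext' fun x r => by
        rw [LinearMap.lTensor_tmul, LinearMap.zero_apply, Submodule.subtype_apply,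
          ← mul_one (r : R), ← smul_eq_mul, ← smul_tmul, hX _ r.2, zero_tmul]
      rw [h0, map_zero, LinearMap.zero_apply]
    · refine ⟨fun hi hM h => ?_, fun hi hM h => ?_⟩
      · exact (ih I).2 (by simpa [parity_simps] using hi) hIkilled (h.ideal hIJ' hm' hM)
      · exact (ih J).1 (by simpa [parity_simps] using hi) hJkilled (h.ideal hIJ hm hM)

theorem hasRelationsIn_right [Nontrivial X] (hIJ : I ⊓ J = ⊥)
    (hm : I ⊔ J = maximalIdeal R) (hI : I ≠ ⊥) (hJ : J ≠ ⊥)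
    (hX : ∀ r ∈ J, ∀ x : X, r • x = 0) (hM : ∀ r ∈ I, ∀ x : M, r • x = 0)
    (hi : Odd i) (h : TorVanishes i R X M) : HasRelationsIn I M := by
  obtain ⟨n, f, hf, hmin⟩ := exists_minimal_cover (R := R) M
  refine ⟨n, f, hf, fun x hx j => ?_⟩
  obtain ⟨q, hq, hqI⟩ := f.exists_retraction_ker_inf_pi (I := J) (J := I) (by rwa [inf_comm])
    (by rwa [sup_comm, hm]) hM
  -- If the `J`-part of the syzygy is zero, each relation equals its `I`-part.
  suffices hs : Subsingleton ↥(LinearMap.ker f ⊓ Submodule.pi Set.univ fun _ => J) by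
    have h1 := hqI ⟨x, hx⟩ j
    rwa [Subsingleton.elim (q ⟨x, hx⟩) 0, Submodule.coe_zero, Pi.zero_apply, sub_zero] at h1
  by_contra hs
  rw [not_subsingleton_iff_nontrivial] at hs
  rcases i with _ | _ | i
  · exact absurd hi (by decide)
  · have h1 := LinearMap.subsingleton_tensorProduct_of_retract X hX (LinearMap.ker f).subtype
      (h.lTensor_ker_subtype_injective f hf) _ q hq fun x i => x.2.2 i trivial
    have := nontrivial_tensorProduct_of_finite (R := R) X
      ↥(LinearMap.ker f ⊓ Submodule.pi Set.univ fun _ => J)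
    exact not_subsingleton _ h1
  · refine (even_and_odd_false hIJ hm hI hJ hX (i + 1) _).1 (by simpa [parity_simps] using hi)
      (fun r hr x => ?_) ((h.ker f hf).of_retract _ q hq)
    ext j
    have h1 : r * (x : Fin n → R) j ∈ I ⊓ J :=
      ⟨I.mul_mem_right _ hr, J.mul_mem_left _ (x.2.2 j trivial)⟩
    rwa [hIJ, Submodule.mem_bot] at h1

/-- Two shifts, through `I` and then `J`, lower the degree by 2 and return to a module killed by
`I`. -/
theorem hasRelationsIn_left (hIJ : I ⊓ J = ⊥)
    (hm : I ⊔ J = maximalIdeal R) (hI : I ≠ ⊥) (hJ : J ≠ ⊥)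
    (hX : ∀ r ∈ J, ∀ x : X, r • x = 0) (n : ℕ) :
    ∀ (M : Type u) [AddCommGroup M] [Module R M] [Module.Finite R M] [Nontrivial M],
      (∀ r ∈ I, ∀ x : M, r • x = 0) → TorVanishes (2 * n + 1) R X M → HasRelationsIn J X := by
  have : Nontrivial I := Submodule.nontrivial_iff_ne_bot.2 hI
  have : Nontrivial J := Submodule.nontrivial_iff_ne_bot.2 hJ
  have hmul (a b : R) (ha : a ∈ I) (hb : b ∈ J) : a * b = 0 := by
    rw [← Ideal.mem_bot, ← hIJ]
    exact ⟨I.mul_mem_right _ ha, J.mul_mem_left _ hb⟩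
  have hm' : J ⊔ I = maximalIdeal R := by rwa [sup_comm]
  have hIJ' : J ⊓ I = ⊥ := by rwa [inf_comm]
  induction n with
  | zero =>
    intro M _ _ _ _ hM h
    exact .of_lTensor_injective hIJ hm X hX (h.lTensor_ideal_subtype_injective hIJ' hm' hM)
  | succ n ih =>
    intro M _ _ _ _ hM h
    have h1 : TorVanishes (2 * n + 2) R X I := TorVanishes.ideal (i := 2 * n + 1) h hIJ' hm' hM
    exact ih J (fun r hr x => Subtype.ext (hmul r x hr x.2)) (h1.ideal hIJ hm fun r hr x =>
      Subtype.ext ((mul_comm r x.1).trans (hmul x r x.2 hr)))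

end CategoryTheory.TorVanishes

/-! ### Change of rings along a surjection -/

/-- A module over a quotient ring all of whose relations vanish in the quotient is free. -/
theorem HasRelationsIn.free_of_surjective {R A : Type*} [CommRing R] [CommRing A] (φ : R →+* A)
    (hφ : Function.Surjective φ) (Y : Type*) [AddCommGroup Y] [Module A Y] [Module R Y]
    (hsmul : ∀ (r : R) (y : Y), r • y = φ r • y) (h : HasRelationsIn (RingHom.ker φ) Y) :
    Module.Free A Y := by
  obtain ⟨n, f, hf, hrel⟩ := h
  have hfx (x : Fin n → R) : f x = ∑ i, φ (x i) • f (Pi.single i 1) := by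
    have h2 := congrArg f (pi_eq_sum_univ' x)
    rw [map_sum] at h2
    simpa only [map_smul, hsmul] using h2
  refine Module.Free.of_basis (Module.Basis.mk (v := fun i => f (Pi.single i 1)) ?_ ?_)
  · rw [Fintype.linearIndependent_iff]
    intro a ha i
    choose x hx using fun i => hφ (a i)
    have h0 : f x = 0 := by rw [hfx]; simpa only [hx] using ha
    rw [← hx]
    exact hrel x h0 i
  · rintro y -
    obtain ⟨x, rfl⟩ := hf y
    rw [hfx]
    exact Submodule.sum_mem _ fun i _ =>
      Submodule.smul_mem _ _ (Submodule.subset_span (Set.mem_range_self i))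

theorem isNoetherian_of_smul_eq {R A : Type*} [CommRing R] [CommRing A] (φ : R →+* A)
    (hφ : Function.Surjective φ) (Y : Type*) [AddCommGroup Y] [Module A Y] [Module R Y]
    (hsmul : ∀ (r : R) (y : Y), r • y = φ r • y) [IsNoetherian A Y] : IsNoetherian R Y := by
  have : RingHomSurjective φ := ⟨hφ⟩
  let l : Y →ₛₗ[φ] Y := { toFun := id, map_add' := fun _ _ => rfl, map_smul' := hsmul }
  exact (l.isNoetherian_iff_of_bijective Function.bijective_id).2 inferInstance

/-! ### The fiber product as a Noetherian local ring -/

namespace fiberProduct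

open IsLocalRing

variable {S T : Type u} {k : Type v} [CommRing S] [CommRing T] [Field k]
  {πS : S →+* k} {πT : T →+* k}

theorem toLeft_surjective (hπT : Function.Surjective πT) :
    Function.Surjective (toLeft πS πT) := fun s =>
  let ⟨t, ht⟩ := hπT (πS s)
  ⟨⟨(s, t), ht.symm⟩, rfl⟩

theorem toRight_surjective (hπS : Function.Surjective πS) :
    Function.Surjective (toRight πS πT) := fun t =>
  let ⟨s, hs⟩ := hπS (πT t)
  ⟨⟨(s, t), hs⟩, rfl⟩

theorem ker_inf_ker : RingHom.ker (toRight πS πT) ⊓ RingHom.ker (toLeft πS πT) = ⊥ := by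
  rw [eq_bot_iff]
  rintro x ⟨h1, h2⟩
  exact Subtype.ext (Prod.ext h2 h1)

theorem ker_sup_ker : RingHom.ker (toRight πS πT) ⊔ RingHom.ker (toLeft πS πT) =
    RingHom.ker (πS.comp (toLeft πS πT)) := by
  apply le_antisymm
  · refine sup_le (fun x hx => ?_) fun x hx => ?_
    · have h : πS x.1.1 = πT x.1.2 := x.2
      have hx : x.1.2 = 0 := hx
      exact h.trans (by rw [hx, map_zero])
    · have hx : x.1.1 = 0 := hx
      exact (congrArg πS hx).trans (map_zero πS)
  · rintro ⟨⟨s, t⟩, hst⟩ hx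
    have hs : πS s = 0 := hx
    have ht : πT t = 0 := Eq.trans (Eq.symm hst) hs
    refine Submodule.mem_sup.2 ⟨⟨(s, 0), hs.trans (map_zero πT).symm⟩, rfl,
      ⟨(0, t), (map_zero πS).trans ht.symm⟩, rfl, ?_⟩
    exact Subtype.ext (Prod.ext (add_zero s) (zero_add t))

theorem ker_sup_ker_eq_maximalIdeal (hπS : Function.Surjective πS)
    (hπT : Function.Surjective πT) [IsLocalRing (fiberProduct πS πT)] :
    RingHom.ker (toRight πS πT) ⊔ RingHom.ker (toLeft πS πT) =
      maximalIdeal (fiberProduct πS πT) := by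
  rw [ker_sup_ker]
  exact eq_maximalIdeal (RingHom.ker_isMaximal_of_surjective _
    (hπS.comp (toLeft_surjective hπT)))

theorem isNoetherianRing [IsNoetherianRing S] [IsNoetherianRing T]
    (hπS : Function.Surjective πS) (hπT : Function.Surjective πT) :
    IsNoetherianRing (fiberProduct πS πT) := by
  let R := fiberProduct πS πT
  let : Module R S := Module.compHom S (toLeft πS πT)
  let : Module R T := Module.compHom T (toRight πS πT)
  let f : R →ₗ[R] S := { toFun := toLeft πS πT, map_add' := map_add _, map_smul' := map_mul _ }
  let g : R →ₗ[R] T := { toFun := toRight πS πT, map_add' := map_add _, map_smul' := map_mul _ }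
  have hS : IsNoetherian R S :=
    isNoetherian_of_smul_eq (toLeft πS πT) (toLeft_surjective hπT) S fun _ _ => rfl
  have hT : IsNoetherian R T :=
    isNoetherian_of_smul_eq (toRight πS πT) (toRight_surjective hπS) T fun _ _ => rfl
  exact isNoetherian_of_injective (f.prod g) fun x y h =>
    Subtype.ext (Prod.ext (congrArg Prod.fst h) (congrArg Prod.snd h))

theorem map_eq_zero_iff_mem_maximalIdeal [IsLocalRing S] (hπS : Function.Surjective πS) (s : S) :
    πS s = 0 ↔ s ∈ maximalIdeal S := by
  have : (RingHom.ker πS).IsMaximal := RingHom.ker_isMaximal_of_surjective πS hπS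
  rw [← eq_maximalIdeal this, RingHom.mem_ker]

theorem isLocalHom_comp_toLeft [IsLocalRing S] [IsLocalRing T]
    (hπS : Function.Surjective πS) (hπT : Function.Surjective πT) :
    IsLocalHom (πS.comp (toLeft πS πT)) := by
  refine ⟨fun x hx => ?_⟩
  obtain ⟨⟨s, t⟩, hst⟩ := x
  have h1 : πS s ≠ 0 := hx.ne_zero
  have h2 : πT t ≠ 0 := fun h => h1 (Eq.trans hst h)
  rw [Ne, map_eq_zero_iff_mem_maximalIdeal hπS, mem_maximalIdeal, mem_nonunits_iff, not_not] at h1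
  rw [Ne, map_eq_zero_iff_mem_maximalIdeal hπT, mem_maximalIdeal, mem_nonunits_iff, not_not] at h2
  obtain ⟨s', hs'⟩ := h1.exists_right_inv
  obtain ⟨t', ht'⟩ := h2.exists_right_inv
  -- Both are inverse to the same element of `k`, so the inverses glue.
  have h3 : πS s' = πT t' := by
    have hu : πS s * πS s' = 1 := by rw [← map_mul, hs', map_one]
    have hv : πS s * πT t' = 1 := by
      rw [show πS s = πT t from hst, ← map_mul, ht', map_one]
    exact mul_left_cancel₀ (left_ne_zero_of_mul_eq_one hu) (hu.trans hv.symm)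
  exact IsUnit.of_mul_eq_one ⟨(s', t'), h3⟩ (Subtype.ext (Prod.ext hs' ht'))

theorem isLocalRing [IsLocalRing S] [IsLocalRing T]
    (hπS : Function.Surjective πS) (hπT : Function.Surjective πT) :
    IsLocalRing (fiberProduct πS πT) :=
  have := isLocalHom_comp_toLeft hπS hπT
  RingHom.domain_isLocalRing (πS.comp (toLeft πS πT))

theorem ker_toRight_ne_bot [IsLocalRing S] (hπS : Function.Surjective πS) (hS : ¬ IsField S) :
    RingHom.ker (toRight πS πT) ≠ ⊥ := by
  intro h
  rw [isField_iff_maximalIdeal_eq] at hS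
  obtain ⟨s, hs, hs0⟩ := Submodule.exists_mem_ne_zero_of_ne_bot hS
  have h1 : πS s = 0 := (map_eq_zero_iff_mem_maximalIdeal hπS s).2 hs
  have h2 : (⟨(s, 0), h1.trans (map_zero πT).symm⟩ : fiberProduct πS πT) ∈
      RingHom.ker (toRight πS πT) := rfl
  rw [h] at h2
  exact hs0 (congrArg (fun x : fiberProduct πS πT => x.1.1) h2)

theorem ker_toLeft_ne_bot [IsLocalRing T] (hπT : Function.Surjective πT) (hT : ¬ IsField T) :
    RingHom.ker (toLeft πS πT) ≠ ⊥ := by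
  intro h
  rw [isField_iff_maximalIdeal_eq] at hT
  obtain ⟨t, ht, ht0⟩ := Submodule.exists_mem_ne_zero_of_ne_bot hT
  have h1 : πT t = 0 := (map_eq_zero_iff_mem_maximalIdeal hπT t).2 ht
  have h2 : (⟨(0, t), (map_zero πS).trans h1.symm⟩ : fiberProduct πS πT) ∈
      RingHom.ker (toLeft πS πT) := rfl
  rw [h] at h2
  exact ht0 (congrArg (fun x : fiberProduct πS πT => x.1.2) h2)

end fiberProduct

theorem mainTheorem8 {S T : Type u} {k : Type v}
    [CommRing S] [IsLocalRing S] [IsNoetherianRing S]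
    [CommRing T] [IsLocalRing T] [IsNoetherianRing T] [Field k]
    (πS : S →+* k) (hπS : Function.Surjective πS)
    (πT : T →+* k) (hπT : Function.Surjective πT)
    (hS : ¬ IsField S) (hT : ¬ IsField T)
    (Y : Type u) [AddCommGroup Y] [Module S Y] [Module.Finite S Y] [Nontrivial Y]
    (Z : Type u) [AddCommGroup Z] [Module T Z] [Module.Finite T Z] [Nontrivial Z]
    (m : ℕ)
    (hTor : CategoryTheory.Limits.IsZero
      (((CategoryTheory.Tor (ModuleCat.{u} (fiberProduct πS πT)) m).obj
          ((ModuleCat.restrictScalars (fiberProduct.toLeft πS πT)).obj (ModuleCat.of S Y))).obj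
        ((ModuleCat.restrictScalars (fiberProduct.toRight πS πT)).obj (ModuleCat.of T Z)))) :
    Odd m ∧ Module.Free S Y ∧ Module.Free T Z := by
  let R := fiberProduct πS πT
  let : Module R Y := Module.compHom Y (fiberProduct.toLeft πS πT)
  let : Module R Z := Module.compHom Z (fiberProduct.toRight πS πT)
  have hRY (r : R) (y : Y) : r • y = fiberProduct.toLeft πS πT r • y := rfl
  have hRZ (r : R) (z : Z) : r • z = fiberProduct.toRight πS πT r • z := rfl
  have : IsNoetherian R Y :=
    isNoetherian_of_smul_eq (fiberProduct.toLeft πS πT) (fiberProduct.toLeft_surjective hπT) Y hRY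
  have : IsNoetherian R Z :=
    isNoetherian_of_smul_eq (fiberProduct.toRight πS πT) (fiberProduct.toRight_surjective hπS) Z hRZ
  -- The `compHom` structures agree definitionally with restriction of scalars.
  have h : CategoryTheory.TorVanishes m R Y Z := hTor
  have := fiberProduct.isLocalRing hπS hπT
  have := fiberProduct.isNoetherianRing hπS hπT
  have hIJ := fiberProduct.ker_inf_ker (πS := πS) (πT := πT)
  have hm := fiberProduct.ker_sup_ker_eq_maximalIdeal hπS hπT
  have hI := fiberProduct.ker_toRight_ne_bot (πT := πT) hπS hS
  have hJ := fiberProduct.ker_toLeft_ne_bot (πS := πS) hπT hT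
  have hY : ∀ r ∈ RingHom.ker (fiberProduct.toLeft πS πT), ∀ y : Y, r • y = 0 := fun r hr y =>
    by
    rw [hRY, RingHom.mem_ker.1 hr, zero_smul]
  have hZ : ∀ r ∈ RingHom.ker (fiberProduct.toRight πS πT), ∀ z : Z, r • z = 0 := fun r hr z =>
    by
    rw [hRZ, RingHom.mem_ker.1 hr, zero_smul]
  have hodd : Odd m := by
    rw [← Nat.not_even_iff_odd]
    exact fun he =>
      (CategoryTheory.TorVanishes.even_and_odd_false hIJ hm hI hJ hY m Z).1 he hZ h
  refine ⟨hodd, ?_, ?_⟩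
  · obtain ⟨n, rfl⟩ := hodd
    exact HasRelationsIn.free_of_surjective (fiberProduct.toLeft πS πT)
      (fiberProduct.toLeft_surjective hπT) Y hRY
      (CategoryTheory.TorVanishes.hasRelationsIn_left hIJ hm hI hJ hY n Z hZ h)
  · exact HasRelationsIn.free_of_surjective (fiberProduct.toRight πS πT)
      (fiberProduct.toRight_surjective hπS) Z hRZ
      (CategoryTheory.TorVanishes.hasRelationsIn_right hIJ hm hI hJ hY hZ hodd h)
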